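/- Let $A$ be an Artin algebra and $\mathrm{mod}\,A$ the category of finitely generated right $A$-modules. For $M\in\mathrm{mod}\,A$ let $\Omega(M)$ be the kernel of the projective cover $P(M)\to M$. Let $K_0(A)$ be the abelian group generated by the symbols $[M]$, $M\in\mathrm{mod}\,A$, modulo the relations $[M]-[M']-[M'']$ whenever $M\cong M'\oplus M''$ and $[P]$ for $P$ projective, and let $\bar\Omega:K_0(A)\to K_0(A)$ be the endomorphism with $\bar\Omega([M])=[\Omega(M)]$. For an endomorphism $L$ of an abelian group $G$ and a subgroup $X\le G$, let $\eta_L(X)$ be the least $l\in\mathbb{N}$ such that $L|_{L^m(X)}$ is injective for all $m\ge l$. For $M\in\mathrm{mod}\,A$ let $\langle\mathrm{add}\,M\rangle\le K_0(A)$ be the subgroup generated by the classes of the indecomposable direct summands of $M$, and let $\phi(M)=\eta_{\bar\Omega}(\langle\mathrm{add}\,M\rangle)$; for $\mathcal{C}\subseteq\mathrm{mod}\,A$ let $\phi\dim(\mathcal{C})=\sup\{\phi(M):M\in\mathcal{C}\}\in\mathbb{N}\cup\{\infty\}$, and $\phi\dim(A)=\phi\dim(\mathrm{mod}\,A)$.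 Let $\mathcal{D}\subseteq\mathrm{mod}\,A$ be a $0$-Igusa-Todorov subcategory with preimages, that is: $\mathcal{D}=\mathrm{add}\,\mathcal{D}$ (where $\mathrm{add}\,\mathcal{D}$ consists of the modules isomorphic to finite direct sums of direct summands of modules in $\mathcal{D}$), $\Omega(\mathcal{D})\subseteq\mathcal{D}$, $\phi\dim(\mathcal{D})=0$, and for every $D\in\mathcal{D}$ there are $D_1,D_2\in\mathcal{D}$ and an integer $m\geq 1$ with $\bar\Omega([D_1]-[D_2])=m[D]$. Let $\langle\mathcal{D}\rangle\le K_0(A)$ be the subgroup generated by the classes of the modules in $\mathcal{D}$, let $\bar\Omega_{\mathcal{D}}$ be the endomorphism of $K_0(A)/\langle\mathcal{D}\rangle$ induced by $\bar\Omega$, and let $$\Phi_{[\mathcal{D}]}(X)=\eta_{\bar\Omega_{\mathcal{D}}}\bigl((\langle\mathrm{add}\,X\rangle+\langle\mathcal{D}\rangle)/\langle\mathcal{D}\rangle\bigr),\qquad \Phi_{[\mathcal{D}]}\dim(A)=\sup\{\Phi_{[\mathcal{D}]}(X):X\in\mathrm{mod}\,A\}.$$ Then $$\phi\dim(A)=\Phi_{[\mathcal{D}]}\dim(A).$$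 -/

import Mathlib

open Function

universe u

namespace IgusaTodorov

noncomputable section

/-- `A` is an Artin algebra: an algebra over some commutative artinian ring `R` which is
finitely generated as an `R`-module. -/
class IsArtinAlgebra (A : Type u) [Ring A] : Prop where
  exists_base : ∃ (R : Type u) (_ : CommRing R) (_ : Algebra R A),
    IsArtinianRing R ∧ Module.Finite R A

/-- Finitely generated right `A`-modules are finitely generated left `Aᵐᵒᵖ`-modules, and `Aᵐᵒᵖ`
is an artinian ring. -/
instance (A : Type u) [Ring A] [h : IsArtinAlgebra A] : IsArtinianRing Aᵐᵒᵖ := by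
  obtain ⟨R, _, _, hR, hA⟩ := h.exists_base
  have : Module.Finite R Aᵐᵒᵖ := Module.Finite.equiv (MulOpposite.opLinearEquiv R)
  exact IsArtinianRing.of_finite R Aᵐᵒᵖ

/-! The remaining definitions concern finitely generated (left) modules over an artinian ring
`B`; they are applied to `B = Aᵐᵒᵖ`. -/

section Modules

variable {B : Type u} [Ring B]

/-- `f : P → M` is a projective cover: `P` is projective, and `f` is surjective with superfluous
kernel. -/
def IsProjectiveCover {P M : Type u} [AddCommGroup P] [Module B P] [AddCommGroup M] [Module B M]
    (f : P →ₗ[B] M) : Prop :=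
  Module.Projective B P ∧ Surjective f ∧
    ∀ K : Submodule B P, K ⊔ LinearMap.ker f = ⊤ → K = ⊤

/-- `N` is (isomorphic to) a direct summand of `M`. -/
def IsSummand (N M : FGModuleCat.{u} B) : Prop :=
  ∃ N' : FGModuleCat.{u} B, Nonempty (M ≃ₗ[B] N × N')

/-- `M` is indecomposable: nonzero, and not a direct sum of two nonzero modules. -/
def IsIndecomposable (M : FGModuleCat.{u} B) : Prop :=
  Nontrivial M ∧ ∀ X Y : FGModuleCat.{u} B, Nonempty (M ≃ₗ[B] X × Y) →
    Subsingleton X ∨ Subsingleton Y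

/-- `add 𝒟`: the modules isomorphic to a finite direct sum of direct summands of modules
in `𝒟`. -/
def addClosure (𝒟 : Set (FGModuleCat.{u} B)) : Set (FGModuleCat.{u} B) :=
  {M | ∃ (n : ℕ) (N : Fin n → FGModuleCat.{u} B),
    (∀ i, ∃ X ∈ 𝒟, IsSummand (N i) X) ∧ Nonempty (M ≃ₗ[B] ((i : Fin n) → N i))}

theorem exists_projectiveCover [IsArtinianRing B] (M : FGModuleCat.{u} B) :
    ∃ (P : FGModuleCat.{u} B) (f : P →ₗ[B] M), IsProjectiveCover f := by
  obtain ⟨n, f, hf⟩ := Module.Finite.exists_fin' B M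
  obtain ⟨N, ⟨hNp, hNs⟩, hmin⟩ := IsArtinian.set_has_minimal
    {N : Submodule B (Fin n → B) | Module.Projective B N ∧ Surjective (f ∘ₗ N.subtype)}
    ⟨⊤, Module.Projective.of_equiv Submodule.topEquiv.symm, fun m => by
      obtain ⟨x, rfl⟩ := hf m
      exact ⟨⟨x, trivial⟩, rfl⟩⟩
  refine ⟨FGModuleCat.of B N, f ∘ₗ N.subtype, hNp, hNs, fun K hK => ?_⟩
  replace hK : ∀ x : N, ∃ k ∈ K, f k.1 = f x.1 := fun x => by
    have hx : x ∈ K ⊔ LinearMap.ker (f ∘ₗ N.subtype) := by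
      change x ∈ (K ⊔ LinearMap.ker (f ∘ₗ N.subtype) : Submodule B N)
      rw [hK]; trivial
    obtain ⟨k, hk, l, hl, rfl⟩ := Submodule.mem_sup.1 hx
    refine ⟨k, hk, ?_⟩
    have : f l.1 = 0 := hl
    simp [this]
  have hKs : Surjective ((f ∘ₗ N.subtype) ∘ₗ K.subtype) := fun m => by
    obtain ⟨x, rfl⟩ := hNs m
    obtain ⟨k, hk, h⟩ := hK x
    exact ⟨⟨k, hk⟩, h⟩
  obtain ⟨g, hg⟩ := Module.projective_lifting_property _ (f ∘ₗ N.subtype) hKs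
  let φ : Module.End B N := K.subtype ∘ₗ g
  have hφ : ∀ x, f (φ x).1 = f x.1 := fun x => LinearMap.congr_fun hg x
  have hφn : ∀ m x, f ((φ ^ m) x).1 = f x.1 := fun m => by
    induction m with
    | zero => intro x; rfl
    | succ m ih => intro x; rw [pow_succ, Module.End.mul_apply, ih, hφ]
  obtain ⟨m, hm⟩ := Filter.eventually_atTop.1 (LinearMap.eventually_isCompl_ker_pow_range_pow φ)
  have hc := hm (m + 1) (Nat.le_succ m)
  set S := LinearMap.range (φ ^ (m + 1)) with hS
  have hSK : S ≤ K := by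
    rintro _ ⟨x, rfl⟩
    rw [pow_succ', Module.End.mul_apply]
    exact (g _).2
  have hSp : Module.Projective B S :=
    Module.Projective.of_split S.subtype (Submodule.projectionOnto S _ hc.symm)
      (LinearMap.ext fun x => Submodule.projectionOnto_apply_left hc.symm x)
  by_contra hne
  refine hmin (S.map N.subtype) ⟨?_, fun z => ?_⟩ ?_
  · exact Module.Projective.of_equiv
      (Submodule.equivMapOfInjective N.subtype N.injective_subtype S)
  · obtain ⟨x, rfl⟩ := hNs z
    exact ⟨⟨_, _, ⟨x, rfl⟩, rfl⟩, hφn (m + 1) x⟩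
  · refine lt_of_le_of_ne (Submodule.map_subtype_le N S) fun h => hne ?_
    refine top_le_iff.1 (le_trans (fun x _ => ?_) hSK)
    obtain ⟨y, hy, hyx⟩ : x.1 ∈ S.map N.subtype := by rw [h]; exact x.2
    have : y = x := Subtype.ext hyx
    exact this ▸ hy

variable [IsArtinianRing B]

/-- The projective cover `P(M)`. -/
def projCover (M : FGModuleCat.{u} B) : FGModuleCat.{u} B := (exists_projectiveCover M).choose

/-- The projective cover map `P(M) → M`. -/
def projCoverMap (M : FGModuleCat.{u} B) : projCover M →ₗ[B] M :=
  (exists_projectiveCover M).choose_spec.choose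

theorem projCoverMap_spec (M : FGModuleCat.{u} B) : IsProjectiveCover (projCoverMap M) :=
  (exists_projectiveCover M).choose_spec.choose_spec

/-- The syzygy `Ω(M)`: the kernel of the projective cover `P(M) → M`. -/
def syzygy (M : FGModuleCat.{u} B) : FGModuleCat.{u} B :=
  FGModuleCat.of B (LinearMap.ker (projCoverMap M))

end Modules

section GrothendieckGroup

variable (B : Type u) [Ring B]

/-- The relations `[M] - [M'] - [M'']` for `M ≅ M' ⊕ M''`, and `[P]` for `P` projective. -/
def K0Relations : Set (FreeAbelianGroup (FGModuleCat.{u} B)) :=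
  {x | ∃ M M' M'' : FGModuleCat.{u} B, Nonempty (M ≃ₗ[B] M' × M'') ∧
      x = FreeAbelianGroup.of M - FreeAbelianGroup.of M' - FreeAbelianGroup.of M''} ∪
  {x | ∃ P : FGModuleCat.{u} B, Module.Projective B P ∧ x = FreeAbelianGroup.of P}

/-- The abelian group `K₀` generated by the symbols `[M]`, `M` a finitely generated module,
modulo the relations above. -/
abbrev K0 : Type (u + 1) :=
  FreeAbelianGroup (FGModuleCat.{u} B) ⧸ AddSubgroup.closure (K0Relations B)

variable {B}

/-- The class `[M]` in `K₀`. -/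
def K0.mk (M : FGModuleCat.{u} B) : K0 B := QuotientAddGroup.mk (FreeAbelianGroup.of M)

theorem K0.mk_of_projective {P : FGModuleCat.{u} B} (h : Module.Projective B P) :
    K0.mk P = 0 :=
  (QuotientAddGroup.eq_zero_iff _).2 (AddSubgroup.subset_closure (Or.inr ⟨P, h, rfl⟩))

theorem K0.mk_of_prod {M M' M'' : FGModuleCat.{u} B} (e : M ≃ₗ[B] M' × M'') :
    K0.mk M = K0.mk M' + K0.mk M'' := by
  have h : (QuotientAddGroup.mk (FreeAbelianGroup.of M - FreeAbelianGroup.of M' -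
      FreeAbelianGroup.of M'') : K0 B) = 0 :=
    (QuotientAddGroup.eq_zero_iff _).2
      (AddSubgroup.subset_closure (Or.inl ⟨M, M', M'', ⟨e⟩, rfl⟩))
  rw [sub_sub] at h
  exact sub_eq_zero.1 h

/-- Schanuel's lemma. -/
theorem schanuel {P Q M : Type u} [AddCommGroup P] [Module B P] [AddCommGroup Q] [Module B Q]
    [AddCommGroup M] [Module B M] [Module.Projective B P] [Module.Projective B Q]
    (p : P →ₗ[B] M) (q : Q →ₗ[B] M) (hp : Surjective p) (hq : Surjective q) :
    Nonempty ((LinearMap.ker p × Q) ≃ₗ[B] (LinearMap.ker q × P)) := by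
  obtain ⟨g, hg⟩ := Module.projective_lifting_property p q hp
  obtain ⟨h, hh⟩ := Module.projective_lifting_property q p hq
  replace hg : ∀ y, p (g y) = q y := fun y => LinearMap.congr_fun hg y
  replace hh : ∀ x, q (h x) = p x := fun x => LinearMap.congr_fun hh x
  refine ⟨{
    toFun := fun z => (⟨z.2 - h (z.1.1 + g z.2), ?_⟩, z.1.1 + g z.2)
    invFun := fun z => (⟨z.2 - g (z.1.1 + h z.2), ?_⟩, z.1.1 + h z.2)
    map_add' := ?_
    map_smul' := ?_
    left_inv := ?_
    right_inv := ?_ }⟩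
  · have : p z.1.1 = 0 := z.1.2
    simp [hg, hh, this]
  · intro x y
    ext
    · simp only [Prod.fst_add, Prod.snd_add, Submodule.coe_add, map_add]; abel
    · simp only [Prod.fst_add, Prod.snd_add, Submodule.coe_add, map_add]; abel
  · intro b x
    ext <;> simp [smul_sub, smul_add]
  · have : q z.1.1 = 0 := z.1.2
    simp [hg, hh, this]
  · rintro ⟨⟨x, hx⟩, y⟩
    ext <;> simp
  · rintro ⟨⟨x, hx⟩, y⟩
    ext <;> simp

variable [IsArtinianRing B]

theorem K0.mk_syzygy {M Q : FGModuleCat.{u} B} (hQ : Module.Projective B Q) (q : Q →ₗ[B] M)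
    (hq : Surjective q) : K0.mk (syzygy M) = K0.mk (FGModuleCat.of B (LinearMap.ker q)) := by
  obtain ⟨hP, hp, _⟩ := projCoverMap_spec M
  obtain ⟨e⟩ := schanuel (projCoverMap M) q hp hq
  have h₁ := K0.mk_of_prod (M := FGModuleCat.of B (syzygy M × Q)) (LinearEquiv.refl B _)
  have h₂ := K0.mk_of_prod (M := FGModuleCat.of B (syzygy M × Q))
    (M' := FGModuleCat.of B (LinearMap.ker q)) (M'' := projCover M) e
  rw [h₁, K0.mk_of_projective hQ, K0.mk_of_projective hP, add_zero, add_zero] at h₂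
  exact h₂

theorem K0.mk_syzygy_of_projective {P : FGModuleCat.{u} B} (h : Module.Projective B P) :
    K0.mk (syzygy P) = 0 := by
  rw [K0.mk_syzygy h LinearMap.id surjective_id]
  refine K0.mk_of_projective ?_
  have : Subsingleton (LinearMap.ker (LinearMap.id : P →ₗ[B] P)) :=
    ⟨fun x y => Subtype.ext (by
      have hx : x.1 = 0 := x.2
      have hy : y.1 = 0 := y.2
      rw [hx, hy])⟩
  exact Module.Projective.of_free

theorem K0.mk_syzygy_of_prod {M M' M'' : FGModuleCat.{u} B} (e : M ≃ₗ[B] M' × M'') :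
    K0.mk (syzygy M) = K0.mk (syzygy M') + K0.mk (syzygy M'') := by
  obtain ⟨hP', hp', _⟩ := projCoverMap_spec M'
  obtain ⟨hP'', hp'', _⟩ := projCoverMap_spec M''
  let q : (projCover M' × projCover M'') →ₗ[B] M :=
    e.symm.toLinearMap ∘ₗ (projCoverMap M').prodMap (projCoverMap M'')
  have hq : Surjective q := e.symm.surjective.comp (Prod.map_surjective.2 ⟨hp', hp''⟩)
  have hker : ∀ z, q z = 0 ↔ projCoverMap M' z.1 = 0 ∧ projCoverMap M'' z.2 = 0 := fun z => by
    change e.symm _ = 0 ↔ _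
    rw [LinearEquiv.map_eq_zero_iff]
    exact Prod.ext_iff
  rw [K0.mk_syzygy (Q := FGModuleCat.of B (projCover M' × projCover M''))
    inferInstance q hq]
  refine K0.mk_of_prod (M' := syzygy M') (M'' := syzygy M'') ?_
  exact
    { toFun := fun z => (⟨z.1.1, ((hker z.1).1 z.2).1⟩, ⟨z.1.2, ((hker z.1).1 z.2).2⟩)
      invFun := fun z => ⟨(z.1.1, z.2.1), (hker _).2 ⟨z.1.2, z.2.2⟩⟩
      map_add' := fun _ _ => rfl
      map_smul' := fun _ _ => rfl
      left_inv := fun _ => rfl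
      right_inv := fun _ => rfl }

variable (B)

/-- The endomorphism `Ω̄` of `K₀` induced by `Ω`, that is `Ω̄ [M] = [Ω M]`. -/
def omegaBar : K0 B →+ K0 B :=
  QuotientAddGroup.lift _ (FreeAbelianGroup.lift fun M => K0.mk (syzygy M)) (by
    rw [AddSubgroup.closure_le]
    rintro _ (⟨M, M', M'', ⟨e⟩, rfl⟩ | ⟨P, hP, rfl⟩)
    · simp [K0.mk_syzygy_of_prod e]
    · simp [K0.mk_syzygy_of_projective hP])

variable {B}

theorem omegaBar_mk (M : FGModuleCat.{u} B) : omegaBar B (K0.mk M) = K0.mk (syzygy M) :=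
  FreeAbelianGroup.lift_apply_of _ _

end GrothendieckGroup

section Functions

/-- `η_L(X)`: the least `l` such that `L` restricted to `L^m(X)` is injective for all `m ≥ l`. -/
def eta {G : Type*} [AddCommGroup G] (L : G →+ G) (X : AddSubgroup G) : ℕ∞ :=
  sInf {l : ℕ∞ | ∃ k : ℕ, l = k ∧
    ∀ m, k ≤ m → Set.InjOn L (L^[m] '' X)}

variable {B : Type u} [Ring B]

/-- `⟨add M⟩`: the subgroup of `K₀` generated by the classes of the indecomposable direct summands
of `M`. -/
def addSpan (M : FGModuleCat.{u} B) : AddSubgroup (K0 B) :=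
  AddSubgroup.closure {x | ∃ N, IsIndecomposable N ∧ IsSummand N M ∧ x = K0.mk N}

/-- `⟨𝒟⟩`: the subgroup of `K₀` generated by the classes of the modules in `𝒟`. -/
def classSpan (𝒟 : Set (FGModuleCat.{u} B)) : AddSubgroup (K0 B) :=
  AddSubgroup.closure (K0.mk '' 𝒟)

variable [IsArtinianRing B]

/-- The Igusa-Todorov function `φ`. -/
def phi (M : FGModuleCat.{u} B) : ℕ∞ := eta (omegaBar B) (addSpan M)

/-- `φdim(𝒞) = sup {φ(M) : M ∈ 𝒞}`. -/
def phiDim (𝒞 : Set (FGModuleCat.{u} B)) : ℕ∞ := ⨆ M ∈ 𝒞, phi M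

/-- `𝒟` is additively closed, `add 𝒟 = 𝒟`, and invariant under syzygies, `Ω(𝒟) ⊆ 𝒟`. -/
structure IsAddOmegaClosed (𝒟 : Set (FGModuleCat.{u} B)) : Prop where
  add_eq : addClosure 𝒟 = 𝒟
  syzygy_mem : ∀ M ∈ 𝒟, syzygy M ∈ 𝒟

theorem IsAddOmegaClosed.le_comap {𝒟 : Set (FGModuleCat.{u} B)} (h : IsAddOmegaClosed 𝒟) :
    classSpan 𝒟 ≤ (classSpan 𝒟).comap (omegaBar B) := by
  rw [classSpan, AddSubgroup.closure_le]
  rintro _ ⟨M, hM, rfl⟩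
  change omegaBar B (K0.mk M) ∈ classSpan 𝒟
  rw [omegaBar_mk]
  exact AddSubgroup.subset_closure (Set.mem_image_of_mem _ (h.syzygy_mem M hM))

/-- The endomorphism `Ω̄_𝒟` of `K_𝒟 = K₀ / ⟨𝒟⟩`, `[X] + ⟨𝒟⟩ ↦ [Ω X] + ⟨𝒟⟩`. -/
def omegaBarRel {𝒟 : Set (FGModuleCat.{u} B)} (h : IsAddOmegaClosed 𝒟) :
    K0 B ⧸ classSpan 𝒟 →+ K0 B ⧸ classSpan 𝒟 :=
  QuotientAddGroup.map (classSpan 𝒟) (classSpan 𝒟) (omegaBar B) h.le_comap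

/-- The generalized function `Φ_[𝒟]`: `η` of `Ω̄_𝒟` on the image of `⟨add X⟩` in `K_𝒟`. -/
def PhiRel {𝒟 : Set (FGModuleCat.{u} B)} (h : IsAddOmegaClosed 𝒟) (X : FGModuleCat.{u} B) : ℕ∞ :=
  eta (omegaBarRel h) ((addSpan X).map (QuotientAddGroup.mk' (classSpan 𝒟)))

/-- `Φ_[𝒟]dim(𝒳) = sup {Φ_[𝒟](X) : X ∈ 𝒳}`. -/
def PhiRelDim {𝒟 : Set (FGModuleCat.{u} B)} (h : IsAddOmegaClosed 𝒟)
    (𝒳 : Set (FGModuleCat.{u} B)) : ℕ∞ :=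
  ⨆ X ∈ 𝒳, PhiRel h X

/-- `𝒟` is a `0`-Igusa-Todorov subcategory. -/
structure IsZeroIT (𝒟 : Set (FGModuleCat.{u} B)) : Prop extends IsAddOmegaClosed 𝒟 where
  phiDim_eq_zero : phiDim 𝒟 = 0

/-- `𝒟` is a `0`-Igusa-Todorov subcategory with preimages. -/
structure IsZeroITWithPreimages (𝒟 : Set (FGModuleCat.{u} B)) : Prop extends IsZeroIT 𝒟 where
  exists_preimage : ∀ M ∈ 𝒟, ∃ D₁ ∈ 𝒟, ∃ D₂ ∈ 𝒟, ∃ m : ℕ, 0 < m ∧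
    omegaBar B (K0.mk D₁ - K0.mk D₂) = m • K0.mk M

end Functions

end

end IgusaTodorov

/-!
Write `L = Ω̄`, `D = ⟨𝒟⟩ ≤ K₀`, and let `L̄` be the endomorphism of `K₀ / D` induced by `L`.

*`φ ≤ Φ_[𝒟]` pointwise* (`eta_le_eta_quotientMap`). Every element of `D` lies in `⟨add N⟩` for some
`N ∈ 𝒟`, so `φdim 𝒟 = 0` says that `L` is injective on `D`. If `L (L^m x) = 0` and `m ≥ Φ_[𝒟](M)`,
then `L^m x` vanishes in `K₀ / D`, that is, it lies in `D`, and hence it is zero.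

*`Φ_[𝒟] ≤ φdim A`* (`eta_quotientMap_le`). Let `m ≥ φdim A` and let `L^(m+1) x ∈ D` with
`x ∈ ⟨add M⟩`. As `D / L(D)` is torsion, so is `D / L^(m+1)(D)`, and there are `n ≥ 1` and `d ∈ D`
with `L^(m+1) (n x - d) = 0`. Choose `N ∈ 𝒟` with `d ∈ ⟨add N⟩`; then `n x - d` lies in
`⟨add (M ⊕ N)⟩`, and `φ(M ⊕ N) ≤ m` gives `L^m (n x - d) = 0`. Hence `n L^m x ∈ D`. Since `K₀ / D`
is torsion-free (`mem_classSpan_of_nsmul_mem`), `L^m x ∈ D`.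

Torsion-freeness is where the Krull-Schmidt theorem enters: modulo `D`, the group `K₀` is generated
by the classes of the non-projective indecomposable modules outside `𝒟`, and for each such `N` the
multiplicity of `N` as a direct summand is a homomorphism `K₀ → ℤ` which kills `D`
(`exists_multiplicity`). The multiplicity of `N` in `M` is obtained as the length over `End N` of
`Hom(M, N) / rad(M, N)`. This is additive in `M` because `End N` is local, and it takes the values
`1` at `M = N` and `0` at each `M` which does not have `N` as a summand.
-/

namespace IgusaTodorov

/-! ### The length of `Hom` modulo its radical -/

section HomModRadical

variable {B : Type u} [Ring B]

theorem isUnit_left_of_isUnit_mul {N : Type u} [AddCommGroup N] [Module B N] [IsNoetherian B N]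
    {a b : Module.End B N} (h : IsUnit (a * b)) : IsUnit a := by
  rw [Module.End.isUnit_iff] at h ⊢
  have hs : Surjective a := Surjective.of_comp (g := b) h.2
  exact ⟨IsNoetherian.injective_of_surjective_endomorphism a hs, hs⟩

variable (B) (M N : Type u) [AddCommGroup M] [Module B M] [AddCommGroup N] [Module B N]
  [IsNoetherian B N] [IsLocalRing (Module.End B N)]

/-- The radical `rad(M, N)` of `Hom(M, N)`, for `N` with local endomorphism ring: the maps `f` such
that `f ∘ g` is never an automorphism of `N`. The ring `End N` acts by postcomposition. -/
def radHom : Submodule (Module.End B N) (M →ₗ[B] N) where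
  carrier := {f | ∀ g : N →ₗ[B] M, ¬ IsUnit (f ∘ₗ g : Module.End B N)}
  add_mem' {f f'} hf hf' g h := by
    rw [LinearMap.add_comp] at h
    exact (IsLocalRing.isUnit_or_isUnit_of_isUnit_add h).elim (hf g) (hf' g)
  zero_mem' g h := by
    rw [LinearMap.zero_comp] at h
    exact not_isUnit_zero h
  smul_mem' a f hf g h := by
    have h' : IsUnit (a * (f ∘ₗ g : Module.End B N)) := h
    obtain ⟨b, rfl⟩ := isUnit_left_of_isUnit_mul h'
    exact hf g (b.isUnit_units_mul _ |>.1 h')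

/-- The length of `Hom(M, N) / rad(M, N)` as a left `End N`-module. For `M` of finite length, this
is the multiplicity of `N` as a direct summand of `M`. -/
noncomputable def multLength : ℕ∞ := Module.length (Module.End B N) ((M →ₗ[B] N) ⧸ radHom B M N)

variable {B M N}

/-- Precomposition with `i`, as an `End N`-linear map. -/
def precomp {M' : Type u} [AddCommGroup M'] [Module B M'] (i : M' →ₗ[B] M) :
    (M →ₗ[B] N) →ₗ[Module.End B N] (M' →ₗ[B] N) where
  toFun f := f ∘ₗ i
  map_add' f g := LinearMap.add_comp i g f
  map_smul' _ _ := rfl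

theorem multLength_of_prod {M' M'' : Type u} [AddCommGroup M'] [Module B M'] [AddCommGroup M'']
    [Module B M''] (e : M ≃ₗ[B] M' × M'') :
    multLength B M N = multLength B M' N + multLength B M'' N := by
  let i : M' →ₗ[B] M := e.symm.toLinearMap ∘ₗ LinearMap.inl B M' M''
  let j : M'' →ₗ[B] M := e.symm.toLinearMap ∘ₗ LinearMap.inr B M' M''
  let p : M →ₗ[B] M' := LinearMap.fst B M' M'' ∘ₗ e.toLinearMap
  let q : M →ₗ[B] M'' := LinearMap.snd B M' M'' ∘ₗ e.toLinearMap
  have hsum : i ∘ₗ p + j ∘ₗ q = LinearMap.id := by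
    ext x
    simp [i, j, p, q, ← map_add]
  let Ψ : (M →ₗ[B] N) →ₗ[Module.End B N]
      ((M' →ₗ[B] N) ⧸ radHom B M' N) × ((M'' →ₗ[B] N) ⧸ radHom B M'' N) :=
    ((radHom B M' N).mkQ ∘ₗ precomp i).prod ((radHom B M'' N).mkQ ∘ₗ precomp j)
  have hΨ : Surjective Ψ := by
    rintro ⟨x, y⟩
    obtain ⟨f, rfl⟩ := Submodule.mkQ_surjective _ x
    obtain ⟨g, rfl⟩ := Submodule.mkQ_surjective _ y
    refine ⟨f ∘ₗ p + g ∘ₗ q, ?_⟩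
    have h₁ : (f ∘ₗ p + g ∘ₗ q) ∘ₗ i = f := by
      ext; simp [p, q, i]
    have h₂ : (f ∘ₗ p + g ∘ₗ q) ∘ₗ j = g := by
      ext; simp [p, q, j]
    exact Prod.ext (congrArg (radHom B M' N).mkQ h₁) (congrArg (radHom B M'' N).mkQ h₂)
  have hker : LinearMap.ker Ψ = radHom B M N := by
    ext f
    have : f ∈ LinearMap.ker Ψ ↔ f ∘ₗ i ∈ radHom B M' N ∧ f ∘ₗ j ∈ radHom B M'' N := by
      rw [LinearMap.mem_ker, Prod.ext_iff]
      exact and_congr (Submodule.Quotient.mk_eq_zero _) (Submodule.Quotient.mk_eq_zero _)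
    rw [this]
    refine ⟨fun h g hg => ?_, fun h => ⟨fun g hg => h (i ∘ₗ g) hg, fun g hg => h (j ∘ₗ g) hg⟩⟩
    have hfg : f ∘ₗ g = (f ∘ₗ i) ∘ₗ (p ∘ₗ g) + (f ∘ₗ j) ∘ₗ (q ∘ₗ g) := by
      calc f ∘ₗ g = f ∘ₗ (i ∘ₗ p + j ∘ₗ q) ∘ₗ g := by rw [hsum, LinearMap.id_comp]
        _ = _ := by rw [LinearMap.add_comp, LinearMap.comp_add]; rfl
    rw [hfg] at hg
    exact (IsLocalRing.isUnit_or_isUnit_of_isUnit_add hg).elim (h.1 _) (h.2 _)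
  rw [multLength, ← hker, (Ψ.quotKerEquivOfSurjective hΨ).length_eq, Module.length_prod]
  rfl

theorem multLength_eq_zero (h : ∀ (f : M →ₗ[B] N) (g : N →ₗ[B] M), f ∘ₗ g ≠ LinearMap.id) :
    multLength B M N = 0 := by
  have : radHom B M N = ⊤ := by
    refine eq_top_iff.2 fun f _ g hg => ?_
    obtain ⟨a, ha⟩ := hg.exists_right_inv
    exact h f (g ∘ₗ a) ha
  rw [multLength, this]
  exact Module.length_eq_zero

theorem multLength_congr {M' : Type u} [AddCommGroup M'] [Module B M'] (e : M ≃ₗ[B] M') :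
    multLength B M N = multLength B M' N := by
  have h : multLength B (PUnit.{u + 1}) N = 0 := multLength_eq_zero fun f g hfg => by
    refine one_ne_zero (α := Module.End B N) ?_
    rw [Module.End.one_eq_id, ← hfg, Subsingleton.elim g 0, LinearMap.comp_zero]
  rw [multLength_of_prod (e.trans
    (LinearEquiv.prodUnique (R := B) (M := M') (M₂ := PUnit.{u + 1})).symm),
    h, add_zero]

theorem multLength_self : multLength B N N = 1 := by
  rw [multLength, Module.length_eq_one_iff, isSimpleModule_iff_isCoatom]
  refine ⟨fun h => ?_, fun K hK => ?_⟩
  · have h1 : (LinearMap.id : N →ₗ[B] N) ∈ radHom B N N := h ▸ Submodule.mem_top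
    exact h1 LinearMap.id isUnit_one
  · obtain ⟨f, hfK, hf⟩ := SetLike.exists_of_lt hK
    obtain ⟨g, hg⟩ : ∃ g : N →ₗ[B] N, IsUnit (f ∘ₗ g : Module.End B N) := by
      by_contra! hc
      exact hf hc
    have hu : IsUnit (f : Module.End B N) := isUnit_left_of_isUnit_mul (b := g) hg
    obtain ⟨a, ha⟩ := hu.exists_left_inv
    refine eq_top_iff.2 fun x _ => ?_
    -- A map outside the radical is an automorphism of `N`, and so it generates `End N`.
    have hx : x = (x * a : Module.End B N) • f := by
      change x = (x * a * f : Module.End B N)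
      rw [mul_assoc, ha, mul_one]
    rw [hx]
    exact K.smul_mem _ hfK

end HomModRadical

/-! ### Krull-Schmidt multiplicities -/

section KrullSchmidt

variable {B : Type u} [Ring B]

/-- A split epimorphism exhibits its target as a direct summand. -/
theorem isSummand_of_comp_eq_id [IsNoetherianRing B] {M N : FGModuleCat.{u} B} {f : M →ₗ[B] N}
    {g : N →ₗ[B] M} (h : f ∘ₗ g = LinearMap.id) : IsSummand N M := by
  have hfg : ∀ x, f (g x) = x := fun x => LinearMap.congr_fun h x
  refine ⟨FGModuleCat.of B (LinearMap.ker f), ⟨?_⟩⟩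
  exact
    { toFun := fun x => (f x, ⟨x - g (f x), by simp [hfg]⟩)
      invFun := fun z => g z.1 + z.2.1
      map_add' := fun x y => by ext <;> simp [add_sub_add_comm]
      map_smul' := fun b x => by ext <;> simp [smul_sub]
      left_inv := fun x => by simp
      right_inv := fun z => by
        have hz : f z.2.1 = 0 := z.2.2
        ext <;> simp [hfg, hz] }

theorem IsSummand.trans {L M N : FGModuleCat.{u} B} (h : IsSummand L M) (h' : IsSummand M N) :
    IsSummand L N := by
  obtain ⟨X, ⟨e⟩⟩ := h
  obtain ⟨Y, ⟨e'⟩⟩ := h'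
  exact ⟨FGModuleCat.of B (X × Y),
    ⟨e'.trans ((e.prodCongr (LinearEquiv.refl B Y)).trans (LinearEquiv.prodAssoc B L X Y))⟩⟩

theorem isSummand_left {M X Y : FGModuleCat.{u} B} (e : M ≃ₗ[B] X × Y) : IsSummand X M :=
  ⟨Y, ⟨e⟩⟩

theorem isSummand_right {M X Y : FGModuleCat.{u} B} (e : M ≃ₗ[B] X × Y) : IsSummand Y M :=
  ⟨X, ⟨e.trans (LinearEquiv.prodComm B X Y)⟩⟩

theorem isSummand_of_linearEquiv {M N : FGModuleCat.{u} B} (e : M ≃ₗ[B] N) : IsSummand N M :=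
  ⟨FGModuleCat.of B PUnit.{u + 1},
    ⟨e.trans (LinearEquiv.prodUnique (R := B) (M := N) (M₂ := PUnit.{u + 1})).symm⟩⟩

theorem IsSummand.projective {P N : FGModuleCat.{u} B} (hP : Module.Projective B P)
    (h : IsSummand N P) : Module.Projective B N := by
  obtain ⟨X, ⟨e⟩⟩ := h
  refine Module.Projective.of_split (M := P) (e.symm.toLinearMap ∘ₗ LinearMap.inl B N X)
    (LinearMap.fst B N X ∘ₗ e.toLinearMap) ?_
  ext; simp

theorem IsIndecomposable.linearEquiv_of_isSummand {M N : FGModuleCat.{u} B}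
    (hM : IsIndecomposable M) (hN : IsIndecomposable N) (h : IsSummand N M) :
    Nonempty (M ≃ₗ[B] N) := by
  obtain ⟨X, ⟨e⟩⟩ := h
  have := hN.1
  have hX : Subsingleton X := (hM.2 N X ⟨e⟩).resolve_left (not_subsingleton N)
  have : Unique X := { default := 0, uniq := fun _ => Subsingleton.elim _ _ }
  exact ⟨e.trans LinearEquiv.prodUnique⟩

variable [IsArtinianRing B]

/-- By Fitting's lemma, an endomorphism of an indecomposable module is invertible or nilpotent. -/
theorem IsIndecomposable.isLocalRing {N : FGModuleCat.{u} B} (hN : IsIndecomposable N) :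
    IsLocalRing (Module.End B N) := by
  have := hN.1
  refine IsLocalRing.of_isUnit_or_isUnit_one_sub_self fun a => ?_
  obtain ⟨m, hm⟩ := Filter.eventually_atTop.1 (LinearMap.eventually_isCompl_ker_pow_range_pow a)
  have hc := hm (m + 1) (Nat.le_succ m)
  rcases hN.2 (FGModuleCat.of B (LinearMap.ker (a ^ (m + 1))))
    (FGModuleCat.of B (LinearMap.range (a ^ (m + 1))))
    ⟨(Submodule.prodEquivOfIsCompl _ _ hc).symm⟩ with h | h
  · left
    have hker : LinearMap.ker (a ^ (m + 1)) = ⊥ := Submodule.subsingleton_iff_eq_bot.1 h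
    have hinj : Injective (a ^ (m + 1)) := LinearMap.ker_eq_bot.1 hker
    rw [Module.End.isUnit_iff]
    refine IsArtinian.bijective_of_injective_endomorphism a ?_
    rw [pow_succ] at hinj
    exact Injective.of_comp (f := (a ^ m : Module.End B N)) hinj
  · right
    have hr : LinearMap.range (a ^ (m + 1)) = ⊥ := Submodule.subsingleton_iff_eq_bot.1 h
    exact IsNilpotent.isUnit_one_sub ⟨m + 1, LinearMap.range_eq_bot.1 hr⟩

/-- Every finitely generated module is a finite direct sum of indecomposable modules, in the form of
an induction principle. -/
@[elab_as_elim]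
theorem fgModule_induction {p : FGModuleCat.{u} B → Prop}
    (zero : ∀ M : FGModuleCat.{u} B, Subsingleton M → p M)
    (indec : ∀ M, IsIndecomposable M → p M)
    (prod : ∀ M X Y : FGModuleCat.{u} B, (M ≃ₗ[B] X × Y) → p X → p Y → p M)
    (M : FGModuleCat.{u} B) : p M := by
  have hfin : ∀ M : FGModuleCat.{u} B, ∃ n : ℕ, Module.length B M = n := fun M =>
    ENat.ne_top_iff_exists.1 (Module.length_ne_top (R := B) (M := M)) |>.imp fun _ h => h.symm
  obtain ⟨n, hn⟩ := hfin M
  induction n using Nat.strong_induction_on generalizing M with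
  | _ n ih =>
    by_cases h0 : Subsingleton M
    · exact zero M h0
    by_cases hM : IsIndecomposable M
    · exact indec M hM
    have hex : ∃ X Y : FGModuleCat.{u} B, Nonempty (M ≃ₗ[B] X × Y) ∧
        ¬ Subsingleton X ∧ ¬ Subsingleton Y := by
      by_contra! hc
      exact hM ⟨not_subsingleton_iff_nontrivial.1 h0, fun X Y e =>
        or_iff_not_imp_left.2 fun hX => hc X Y e (not_subsingleton_iff_nontrivial.1 hX)⟩
    obtain ⟨X, Y, ⟨e⟩, hX, hY⟩ := hex
    obtain ⟨a, ha⟩ := hfin X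
    obtain ⟨b, hb⟩ := hfin Y
    have hab : n = a + b := by
      have h := e.length_eq
      rw [Module.length_prod, hn, ha, hb] at h
      exact_mod_cast h
    have ha0 : a ≠ 0 := by
      rintro rfl
      exact hX (Module.length_eq_zero_iff.1 (by simpa using ha))
    have hb0 : b ≠ 0 := by
      rintro rfl
      exact hY (Module.length_eq_zero_iff.1 (by simpa using hb))
    exact prod M X Y e (ih a (by omega) X ha) (ih b (by omega) Y hb)

theorem multLength_eq_zero_of_not_isSummand {M N : FGModuleCat.{u} B}
    [IsLocalRing (Module.End B N)] (h : ¬ IsSummand N M) : multLength B M N = 0 :=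
  multLength_eq_zero fun _ _ hfg => h (isSummand_of_comp_eq_id hfg)

theorem multLength_ne_top {N : FGModuleCat.{u} B} (hN : IsIndecomposable N)
    [IsLocalRing (Module.End B N)] (M : FGModuleCat.{u} B) : multLength B M N ≠ ⊤ := by
  induction M using fgModule_induction with
  | zero M hM =>
    rw [multLength_eq_zero fun f g hfg => one_ne_zero (α := Module.End B N) ?_]
    · exact ENat.zero_ne_top
    · rw [Module.End.one_eq_id, ← hfg, Subsingleton.elim g 0, LinearMap.comp_zero]
  | indec M hM =>
    by_cases h : IsSummand N M
    · obtain ⟨e⟩ := hM.linearEquiv_of_isSummand hN h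
      rw [multLength_congr e, multLength_self]
      exact ENat.one_ne_top
    · rw [multLength_eq_zero_of_not_isSummand h]
      exact ENat.zero_ne_top
  | prod M X Y e hX hY =>
    rw [multLength_of_prod e]
    exact WithTop.add_ne_top.2 ⟨hX, hY⟩

/-- For a non-projective indecomposable `N`, the multiplicity of `N` as a direct summand defines a
homomorphism `K₀ → ℤ`. -/
theorem exists_multiplicity {N : FGModuleCat.{u} B} (hN : IsIndecomposable N)
    (hNP : ¬ Module.Projective B N) :
    ∃ μ : K0 B →+ ℤ, μ (K0.mk N) = 1 ∧
      ∀ M : FGModuleCat.{u} B, ¬ IsSummand N M → μ (K0.mk M) = 0 := by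
  have := hN.isLocalRing
  let m : FGModuleCat.{u} B → ℤ := fun M => ((multLength B M N).toNat : ℤ)
  have hm : ∀ M, ¬ IsSummand N M → m M = 0 := fun M h => by
    simp [m, multLength_eq_zero_of_not_isSummand h]
  refine ⟨QuotientAddGroup.lift _ (FreeAbelianGroup.lift m) ?_, ?_, fun M h => ?_⟩
  · rw [AddSubgroup.closure_le]
    rintro _ (⟨M, M', M'', ⟨e⟩, rfl⟩ | ⟨P, hP, rfl⟩)
    · have : m M = m M' + m M'' := by
        simp only [m]
        rw [multLength_of_prod e, ENat.toNat_add (multLength_ne_top hN _) (multLength_ne_top hN _)]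
        push_cast
        rfl
      simp [this]
    · simp [hm P fun h => hNP (h.projective hP)]
  · refine (FreeAbelianGroup.lift_apply_of m N).trans ?_
    simp [m, multLength_self]
  · exact (FreeAbelianGroup.lift_apply_of m M).trans (hm M h)

end KrullSchmidt

/-! ### The function `η` and quotients -/

section Eta

variable {G : Type*} [AddCommGroup G]

/-- As `L` and `X` are additive, injectivity of `L` on `L^m(X)` is tested on the kernel of `L`. -/
theorem eta_le_natCast_iff {L : G →+ G} {X : AddSubgroup G} {k : ℕ} :
    eta L X ≤ k ↔ ∀ m, k ≤ m → ∀ x ∈ X, L (L^[m] x) = 0 → L^[m] x = 0 := by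
  have hinj : ∀ m, Set.InjOn L (L^[m] '' X) ↔ ∀ x ∈ X, L (L^[m] x) = 0 → L^[m] x = 0 := by
    refine fun m => ⟨fun h x hx hLx => ?_, fun h => ?_⟩
    · exact h ⟨x, hx, rfl⟩ ⟨0, X.zero_mem, iterate_map_zero L m⟩ (hLx.trans (map_zero L).symm)
    · rintro _ ⟨x, hx, rfl⟩ _ ⟨y, hy, rfl⟩ hxy
      have := h (x - y) (X.sub_mem hx hy)
      rw [iterate_map_sub, map_sub, sub_eq_zero, sub_eq_zero] at this
      exact this hxy
  refine ⟨fun h m hm => (hinj m).1 ?_, fun h => sInf_le ⟨k, rfl, fun m hm => (hinj m).2 (h m hm)⟩⟩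
  have hne : {l : ℕ∞ | ∃ k : ℕ, l = k ∧ ∀ m, k ≤ m → Set.InjOn L (L^[m] '' X)}.Nonempty := by
    by_contra hc
    rw [Set.not_nonempty_iff_eq_empty] at hc
    rw [eta, hc, sInf_empty] at h
    exact ENat.natCast_ne_top k (top_le_iff.1 h)
  obtain ⟨l, hl, hinjl⟩ := csInf_mem hne
  have hlk : l ≤ k := by
    have : (l : ℕ∞) ≤ k := hl ▸ h
    exact_mod_cast this
  exact hinjl m (hlk.trans hm)

variable {L : G →+ G} {D X : AddSubgroup G}

theorem iterate_quotientMap_mk (hD : D ≤ D.comap L) (m : ℕ) (x : G) :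
    (QuotientAddGroup.map D D L hD)^[m] (QuotientAddGroup.mk x) =
      QuotientAddGroup.mk (L^[m] x) :=
  ((Semiconj.iterate_right (f := (QuotientAddGroup.mk : G → G ⧸ D)) (ga := L)
    (gb := QuotientAddGroup.map D D L hD) (fun _ => rfl) m) x).symm

theorem eta_le_eta_quotientMap (hD : D ≤ D.comap L) (hinj : ∀ d ∈ D, L d = 0 → d = 0) :
    eta L X ≤ eta (QuotientAddGroup.map D D L hD) (X.map (QuotientAddGroup.mk' D)) := by
  rcases eq_or_ne (eta (QuotientAddGroup.map D D L hD) (X.map (QuotientAddGroup.mk' D))) ⊤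
    with h | h
  · exact h ▸ le_top
  obtain ⟨k, hk⟩ := ENat.ne_top_iff_exists.1 h
  rw [← hk, eta_le_natCast_iff]
  intro m hm x hx hLx
  have hmem : L^[m] x ∈ D := by
    have h0 := eta_le_natCast_iff.1 hk.ge m hm _ ⟨x, hx, rfl⟩
    rw [QuotientAddGroup.mk'_apply, iterate_quotientMap_mk hD, QuotientAddGroup.map_mk, hLx] at h0
    exact (QuotientAddGroup.eq_zero_iff _).1 (h0 rfl)
  exact hinj _ hmem hLx

/-- The hypothesis `hk` is needed for subgroups `Y` larger than `X`, since an element of `X` has to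
be corrected by one of `D` before it lies in the kernel of an iterate of `L`. -/
theorem eta_quotientMap_le (hD : D ≤ D.comap L)
    (htors : ∀ (n : ℕ) (g : G), 0 < n → n • g ∈ D → g ∈ D)
    (hpre : ∀ d ∈ D, ∃ n : ℕ, 0 < n ∧ ∃ d' ∈ D, L d' = n • d) {k : ℕ}
    (hk : ∀ d ∈ D, ∃ Y : AddSubgroup G, X ≤ Y ∧ d ∈ Y ∧ eta L Y ≤ k) :
    eta (QuotientAddGroup.map D D L hD) (X.map (QuotientAddGroup.mk' D)) ≤ k := by
  -- `D / L^m(D)` is torsion for every `m`.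
  have hpre_iter : ∀ (m : ℕ), ∀ d ∈ D, ∃ n : ℕ, 0 < n ∧ ∃ d' ∈ D, L^[m] d' = n • d := by
    intro m
    induction m with
    | zero => exact fun d hd => ⟨1, one_pos, d, hd, by simp⟩
    | succ m ih =>
      intro d hd
      obtain ⟨n, hn, d', hd', h⟩ := hpre d hd
      obtain ⟨n', hn', d'', hd'', h'⟩ := ih d' hd'
      refine ⟨n' * n, Nat.mul_pos hn' hn, d'', hd'', ?_⟩
      rw [iterate_succ_apply', h', map_nsmul, h, mul_nsmul']
  rw [eta_le_natCast_iff]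
  rintro m hm _ ⟨x, hx, rfl⟩ h
  rw [QuotientAddGroup.mk'_apply, iterate_quotientMap_mk hD] at h ⊢
  rw [QuotientAddGroup.map_mk, QuotientAddGroup.eq_zero_iff, ← iterate_succ_apply' L] at h
  rw [QuotientAddGroup.eq_zero_iff]
  obtain ⟨n, hn, d, hd, hnd⟩ := hpre_iter (m + 1) _ h
  obtain ⟨Y, hXY, hdY, hY⟩ := hk d hd
  have hzero : L^[m] (n • x - d) = 0 := by
    refine eta_le_natCast_iff.1 hY m hm _ (Y.sub_mem (Y.nsmul_mem (hXY hx) n) hdY) ?_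
    rw [← iterate_succ_apply' L, iterate_map_sub, iterate_map_nsmul, hnd, sub_self]
  rw [iterate_map_sub, iterate_map_nsmul, sub_eq_zero] at hzero
  refine htors n _ hn (hzero ▸ ?_)
  have hmaps : Set.MapsTo L D D := fun d hd => hD hd
  exact hmaps.iterate m hd

end Eta

/-! ### The subgroups `⟨add M⟩` and `⟨𝒟⟩` of `K₀` -/

section AddSpan

variable {B : Type u} [Ring B]

theorem addSpan_mono {M N : FGModuleCat.{u} B} (h : IsSummand M N) : addSpan M ≤ addSpan N :=
  AddSubgroup.closure_mono fun _ ⟨X, hX, hXM, hx⟩ => ⟨X, hX, hXM.trans h, hx⟩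

theorem mk_mem_addSpan [IsArtinianRing B] (M : FGModuleCat.{u} B) : K0.mk M ∈ addSpan M := by
  induction M using fgModule_induction with
  | zero M hM =>
    rw [K0.mk_of_projective Module.Projective.of_free]
    exact zero_mem _
  | indec M hM =>
    exact AddSubgroup.subset_closure
      ⟨M, hM, isSummand_of_linearEquiv (LinearEquiv.refl B M), rfl⟩
  | prod M X Y e hX hY =>
    rw [K0.mk_of_prod e]
    exact add_mem (addSpan_mono (isSummand_left e) hX) (addSpan_mono (isSummand_right e) hY)

theorem K0.mk_congr {M N : FGModuleCat.{u} B} (e : M ≃ₗ[B] N) : K0.mk M = K0.mk N := by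
  rw [K0.mk_of_prod (M'' := FGModuleCat.of B PUnit.{u + 1})
    (e.trans (LinearEquiv.prodUnique (R := B) (M := N) (M₂ := PUnit.{u + 1})).symm),
    K0.mk_of_projective (P := FGModuleCat.of B PUnit.{u + 1})
      (inferInstanceAs (Module.Projective B PUnit.{u + 1})), add_zero]

variable {𝒟 : Set (FGModuleCat.{u} B)}

theorem mem_of_isSummand (h𝒟 : addClosure 𝒟 = 𝒟) {M N : FGModuleCat.{u} B} (hM : M ∈ 𝒟)
    (h : IsSummand N M) : N ∈ 𝒟 := by
  rw [← h𝒟]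
  exact ⟨1, fun _ => N, fun _ => ⟨M, hM, h⟩,
    ⟨(LinearEquiv.funUnique (Fin 1) B N).symm⟩⟩

theorem prod_mem (h𝒟 : addClosure 𝒟 = 𝒟) {M N : FGModuleCat.{u} B} (hM : M ∈ 𝒟) (hN : N ∈ 𝒟) :
    FGModuleCat.of B (M × N) ∈ 𝒟 := by
  rw [← h𝒟]
  refine ⟨2, ![M, N], fun i => ?_,
    ⟨(LinearEquiv.piFinTwo B fun i => (![M, N] i : FGModuleCat.{u} B)).symm⟩⟩
  fin_cases i
  · exact ⟨M, hM, isSummand_of_linearEquiv (LinearEquiv.refl B M)⟩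
  · exact ⟨N, hN, isSummand_of_linearEquiv (LinearEquiv.refl B N)⟩

theorem punit_mem (h𝒟 : addClosure 𝒟 = 𝒟) : FGModuleCat.of B PUnit.{u + 1} ∈ 𝒟 := by
  rw [← h𝒟]
  exact ⟨0, Fin.elim0, fun i => i.elim0, ⟨LinearEquiv.ofSubsingleton _ _⟩⟩

/-- The class of `M` lies in `⟨add M⟩` by decomposition into indecomposables, and `⟨add M⟩` and
`⟨add N⟩` are contained in `⟨add (M ⊕ N)⟩`. -/
theorem exists_mem_addSpan_of_mem_classSpan [IsArtinianRing B] (h𝒟 : addClosure 𝒟 = 𝒟)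
    {d : K0 B} (hd : d ∈ classSpan 𝒟) : ∃ M ∈ 𝒟, d ∈ addSpan M := by
  induction hd using AddSubgroup.closure_induction with
  | mem x hx =>
    obtain ⟨M, hM, rfl⟩ := hx
    exact ⟨M, hM, mk_mem_addSpan M⟩
  | zero => exact ⟨_, punit_mem h𝒟, zero_mem _⟩
  | add x y _ _ hx hy =>
    obtain ⟨M, hM, hx⟩ := hx
    obtain ⟨N, hN, hy⟩ := hy
    exact ⟨_, prod_mem h𝒟 hM hN,
      add_mem (addSpan_mono (isSummand_left (LinearEquiv.refl B (M × N))) hx)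
        (addSpan_mono (isSummand_right (LinearEquiv.refl B (M × N))) hy)⟩
  | neg x _ hx =>
    obtain ⟨M, hM, hx⟩ := hx
    exact ⟨M, hM, neg_mem hx⟩

/-- Existence of preimages passes from the generators to all of `⟨𝒟⟩`: the group `⟨𝒟⟩ / Ω̄⟨𝒟⟩` is
torsion. -/
theorem exists_preimage_of_mem_classSpan [IsArtinianRing B] (h : IsZeroITWithPreimages 𝒟) :
    ∀ d ∈ classSpan 𝒟, ∃ n : ℕ, 0 < n ∧ ∃ d' ∈ classSpan 𝒟, omegaBar B d' = n • d := by
  intro d hd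
  induction hd using AddSubgroup.closure_induction with
  | mem x hx =>
    obtain ⟨M, hM, rfl⟩ := hx
    obtain ⟨D₁, h₁, D₂, h₂, m, hm, he⟩ := h.exists_preimage M hM
    exact ⟨m, hm, _, sub_mem (AddSubgroup.subset_closure ⟨D₁, h₁, rfl⟩)
      (AddSubgroup.subset_closure ⟨D₂, h₂, rfl⟩), he⟩
  | zero => exact ⟨1, one_pos, 0, zero_mem _, by simp⟩
  | add x y _ _ hx hy =>
    obtain ⟨a, ha, x', hx', hx⟩ := hx
    obtain ⟨b, hb, y', hy', hy⟩ := hy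
    refine ⟨a * b, Nat.mul_pos ha hb, b • x' + a • y',
      add_mem (nsmul_mem hx' b) (nsmul_mem hy' a), ?_⟩
    rw [map_add, map_nsmul, map_nsmul, hx, hy, nsmul_add, mul_nsmul, mul_nsmul']
  | neg x _ hx =>
    obtain ⟨a, ha, x', hx', hx⟩ := hx
    exact ⟨a, ha, -x', neg_mem hx', by rw [map_neg, hx, smul_neg]⟩

/-- `K₀ / ⟨𝒟⟩` is torsion-free. -/
theorem mem_classSpan_of_nsmul_mem [IsArtinianRing B] (h𝒟 : addClosure 𝒟 = 𝒟) {n : ℕ}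
    (hn : 0 < n) {g : K0 B} (hg : n • g ∈ classSpan 𝒟) : g ∈ classSpan 𝒟 := by
  -- `Quotient r` is the set of isomorphism classes of non-projective indecomposables outside `𝒟`;
  -- modulo `⟨𝒟⟩`, every element of `K₀` is an integral combination of their classes.
  let S : Type (u + 1) := {N : FGModuleCat.{u} B //
    IsIndecomposable N ∧ ¬ Module.Projective B N ∧ N ∉ 𝒟}
  let r : Setoid S :=
    { r := fun M N => Nonempty (M.1 ≃ₗ[B] N.1)
      iseqv := ⟨fun M => ⟨LinearEquiv.refl B M.1⟩, fun ⟨e⟩ => ⟨e.symm⟩,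
        fun ⟨e⟩ ⟨e'⟩ => ⟨e.trans e'⟩⟩ }
  let rep : Quotient r → FGModuleCat.{u} B := fun i => i.out.1
  let H : AddSubgroup (K0 B) :=
    classSpan 𝒟 ⊔ (Submodule.span ℤ (Set.range fun i => K0.mk (rep i))).toAddSubgroup
  have hmk : ∀ M : FGModuleCat.{u} B, K0.mk M ∈ H := by
    intro M
    induction M using fgModule_induction with
    | zero M hM =>
      rw [K0.mk_of_projective Module.Projective.of_free]
      exact zero_mem _
    | prod M X Y e hX hY =>
      rw [K0.mk_of_prod e]
      exact add_mem hX hY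
    | indec M hM =>
      by_cases hP : Module.Projective B M
      · rw [K0.mk_of_projective hP]
        exact zero_mem _
      by_cases hMD : M ∈ 𝒟
      · exact AddSubgroup.mem_sup_left (AddSubgroup.subset_closure ⟨M, hMD, rfl⟩)
      let i : Quotient r := Quotient.mk r ⟨M, hM, hP, hMD⟩
      obtain ⟨e⟩ : Nonempty (rep i ≃ₗ[B] M) := Quotient.mk_out (s := r) ⟨M, hM, hP, hMD⟩
      rw [← K0.mk_congr e]
      exact AddSubgroup.mem_sup_right (Submodule.subset_span ⟨i, rfl⟩)
  have hH : ∀ x : K0 B, x ∈ H := fun x => by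
    induction x using QuotientAddGroup.induction_on with
    | H x =>
      induction x using FreeAbelianGroup.induction_on with
      | zero => exact zero_mem H
      | of M => exact hmk M
      | neg M h => exact neg_mem h
      | add x y hx hy => exact add_mem hx hy
  obtain ⟨d, hd, s, hs, rfl⟩ := AddSubgroup.mem_sup.1 (hH g)
  obtain ⟨c, rfl⟩ := Finsupp.mem_span_range_iff_exists_finsupp.1 hs
  -- The coefficients vanish, as the multiplicities detect them and kill `⟨𝒟⟩`.
  suffices hc : c = 0 by simpa [hc] using hd
  ext i
  obtain ⟨μ, hμ, hμ0⟩ := exists_multiplicity i.out.2.1 i.out.2.2.1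
  have hμD : classSpan 𝒟 ≤ μ.ker := by
    rw [classSpan, AddSubgroup.closure_le]
    rintro _ ⟨M, hM, rfl⟩
    exact hμ0 M fun h => i.out.2.2.2 (mem_of_isSummand h𝒟 hM h)
  have hμj : ∀ j, j ≠ i → μ (K0.mk (rep j)) = 0 := fun j hj => hμ0 _ fun h =>
    hj (Quotient.out_equiv_out.1 (j.out.2.1.linearEquiv_of_isSummand i.out.2.1 h))
  have hμs : μ (c.sum fun j a => a • K0.mk (rep j)) = c i := by
    rw [map_finsuppSum, Finsupp.sum_eq_single i]
    · rw [map_zsmul, hμ, smul_eq_mul, mul_one]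
    · intro j _ hj
      rw [map_zsmul, hμj j hj, smul_zero]
    · simp
  have h0 : μ (n • (d + c.sum fun j a => a • K0.mk (rep j))) = 0 := hμD hg
  rw [map_nsmul, map_add, hμs, show μ d = 0 from hμD hd, zero_add, nsmul_eq_mul] at h0
  simpa [hn.ne'] using h0

end AddSpan

end IgusaTodorov

open IgusaTodorov in
theorem mainTheorem2 {A : Type u} [Ring A] [IgusaTodorov.IsArtinAlgebra A]
    (𝒟 : Set (FGModuleCat.{u} Aᵐᵒᵖ)) (h𝒟 : IgusaTodorov.IsZeroITWithPreimages 𝒟) :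
    IgusaTodorov.phiDim (Set.univ : Set (FGModuleCat.{u} Aᵐᵒᵖ)) =
      IgusaTodorov.PhiRelDim h𝒟.toIsAddOmegaClosed Set.univ := by
  have hadd := h𝒟.add_eq
  refine le_antisymm (iSup₂_mono fun M _ => ?_) (iSup₂_le fun M _ => ?_)
  · refine eta_le_eta_quotientMap h𝒟.le_comap fun d hd hLd => ?_
    obtain ⟨N, hN, hdN⟩ := exists_mem_addSpan_of_mem_classSpan hadd hd
    have hφ : phi N ≤ (0 : ℕ) :=
      (le_iSup₂ (f := fun M (_ : M ∈ 𝒟) => phi M) N hN).trans h𝒟.phiDim_eq_zero.le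
    exact eta_le_natCast_iff.1 hφ 0 le_rfl d hdN hLd
  · rcases eq_or_ne (phiDim (Set.univ : Set (FGModuleCat.{u} Aᵐᵒᵖ))) ⊤ with h | h
    · exact h ▸ le_top
    obtain ⟨k, hk⟩ := ENat.ne_top_iff_exists.1 h
    rw [← hk]
    refine eta_quotientMap_le h𝒟.le_comap
      (fun n g hn hg => mem_classSpan_of_nsmul_mem hadd hn hg) (exists_preimage_of_mem_classSpan h𝒟)
      fun d hd => ?_
    obtain ⟨N, _, hdN⟩ := exists_mem_addSpan_of_mem_classSpan hadd hd
    refine ⟨addSpan (FGModuleCat.of Aᵐᵒᵖ (M × N)),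
      addSpan_mono (isSummand_left (LinearEquiv.refl _ (M × N))),
      addSpan_mono (isSummand_right (LinearEquiv.refl _ (M × N))) hdN, ?_⟩
    rw [hk]
    exact le_iSup₂ (f := fun M (_ : M ∈ Set.univ) => phi M) _ (Set.mem_univ _)
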